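/- Let $H$ be a complex Hilbert space and let $T$ be a bounded linear operator on $H$ with $\|T\|\le 1$. Put $D_T=(I-T^*T)^{1/2}$, $D_{T^*}=(I-TT^*)^{1/2}$, $\mathfrak D_T=\overline{\operatorname{ran}}\,D_T$ and $\mathfrak D_{T^*}=\overline{\operatorname{ran}}\,D_{T^*}$. Assume that $T$ has rank one defects, i.e. $\dim\mathfrak D_T=\dim\mathfrak D_{T^*}=1$, and that $T$ is completely nonunitary, i.e. there is no nonzero closed subspace reducing $T$ on which $T$ acts as a unitary operator. Let $$\Theta_T(z)=\bigl(-T+zD_{T^*}(I-zT^*)^{-1}D_T\bigr)\big|_{\mathfrak D_T}:\mathfrak D_T\to\mathfrak D_{T^*},\qquad |z|<1,$$ be the (Sz.-Nagy--Foias) characteristic function of $T$. Then there exists a Borel probability measure $\mu$ on the unit circle $\mathbb T$ such that the following two statements hold. 1. $T$ is unitarily equivalent to the operator $\mathcal T$ on $\mathfrak K:=L^2(\mathbb T,d\mu)\ominus\mathbb C$ (the orthogonal complement of the constant functions) given by $\mathcal T h=P_{\mathfrak K}(\zeta h)$, $h\in\mathfrak K$, where $P_{\mathfrak K}$ is the orthogonal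 projection of $L^2(\mathbb T,d\mu)$ onto $\mathfrak K$. 2. The Schur function of $\mu$, $$f(z)=\frac1z\,\frac{F(z)-1}{F(z)+1},\qquad F(z)=\int_{\mathbb T}\frac{\zeta+z}{\zeta-z}\,d\mu(\zeta),\qquad |z|<1$$ (with the removable singularity at $z=0$ removed), agrees with the characteristic function of $T$: there are unitary operators $V:\mathfrak D_{T^*}\to\mathbb C$ and $W:\mathbb C\to\mathfrak D_T$ such that $V\,\Theta_T(z)\,W=f(z)$ for all $|z|<1$, where $f(z)$ acts on $\mathbb C$ as multiplication. -/

import Mathlib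

open MeasureTheory ContinuousLinearMap

noncomputable section

namespace RankOneDefect

section Operators

variable {H : Type*} [NormedAddCommGroup H] [InnerProductSpace ℂ H] [CompleteSpace H]

/-- The defect operator `D_T = (I - T* T)^{1/2}` (positive square root). For a contraction `T`
the operator `I - T* T` is nonnegative. The defect operator of the adjoint is
`defectOp (adjoint T) = (I - T T*)^{1/2}`. -/
def defectOp (T : H →L[ℂ] H) : H →L[ℂ] H :=
  CFC.sqrt (1 - adjoint T * T)

/-- The defect subspace: the closure of the range of the defect operator. -/
def defectSpace (T : H →L[ℂ] H) : Submodule ℂ H :=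
  (defectOp T).range.topologicalClosure

/-- `T` is completely nonunitary: the only closed subspace `M` reducing `T` (that is, `M` and its
orthogonal complement are both invariant under `T`) on which `T` acts as a unitary operator
(isometrically, and onto `M`) is the zero subspace. -/
def IsCompletelyNonunitary (T : H →L[ℂ] H) : Prop :=
  ∀ M : Submodule ℂ H, IsClosed (M : Set H) →
    (∀ x ∈ M, T x ∈ M) → (∀ x ∈ Mᗮ, T x ∈ Mᗮ) →
    (∀ x ∈ M, ‖T x‖ = ‖x‖) → (∀ y ∈ M, ∃ x ∈ M, T x = y) →
    M = ⊥

theorem norm_adjoint_le_one {T : H →L[ℂ] H} (hT : ‖T‖ ≤ 1) : ‖adjoint T‖ ≤ 1 := by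
  rwa [LinearIsometryEquiv.norm_map]

theorem defect_nonneg {T : H →L[ℂ] H} (hT : ‖T‖ ≤ 1) : 0 ≤ 1 - adjoint T * T := by
  have h : ‖adjoint T * T‖ ≤ 1 := by
    refine (norm_mul_le _ _).trans ?_
    exact mul_le_one₀ (norm_adjoint_le_one hT) (norm_nonneg _) hT
  have hs : IsSelfAdjoint (adjoint T * T) := IsSelfAdjoint.star_mul_self T
  rw [sub_nonneg]
  exact (CStarAlgebra.norm_le_one_iff_of_nonneg _ (star_mul_self_nonneg T)).1 h

theorem defectOp_mul_self {T : H →L[ℂ] H} (hT : ‖T‖ ≤ 1) :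
    defectOp T * defectOp T = 1 - adjoint T * T :=
  CFC.sqrt_mul_sqrt_self _ (defect_nonneg hT)

theorem isSelfAdjoint_defectOp (T : H →L[ℂ] H) : IsSelfAdjoint (defectOp T) :=
  IsSelfAdjoint.of_nonneg (CFC.sqrt_nonneg _)

/-- The defect subspace is also the closure of the range of `D_T² = I - T* T`. -/
theorem defectSpace_eq {T : H →L[ℂ] H} (hT : ‖T‖ ≤ 1) :
    defectSpace T = (1 - adjoint T * T : H →L[ℂ] H).range.topologicalClosure := by
  have hD : adjoint (defectOp T) = defectOp T := isSelfAdjoint_defectOp T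
  have hE : adjoint (1 - adjoint T * T : H →L[ℂ] H) = 1 - adjoint T * T := by
    rw [← defectOp_mul_self hT, ContinuousLinearMap.mul_def, adjoint_comp, hD]
  rw [defectSpace, ← Submodule.orthogonal_orthogonal_eq_closure,
    ← Submodule.orthogonal_orthogonal_eq_closure]
  congr 1
  rw [ContinuousLinearMap.orthogonal_range, ContinuousLinearMap.orthogonal_range, hD, hE]
  ext x
  rw [← defectOp_mul_self hT]
  constructor
  · intro hx
    have hx' : defectOp T x = 0 := hx
    change defectOp T (defectOp T x) = 0
    rw [hx', map_zero]
  · intro hx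
    have hx' : defectOp T (defectOp T x) = 0 := hx
    change defectOp T x = 0
    have h := ContinuousLinearMap.adjoint_inner_left (defectOp T) x (defectOp T x)
    rw [hD, hx', inner_zero_left] at h
    exact inner_self_eq_zero.1 h.symm

/-- A contraction maps its defect subspace into the defect subspace of its adjoint. -/
theorem map_mem_defectSpace {T : H →L[ℂ] H} (hT : ‖T‖ ≤ 1) {x : H} (hx : x ∈ defectSpace T) :
    T x ∈ defectSpace (adjoint T) := by
  rw [defectSpace_eq (norm_adjoint_le_one hT), adjoint_adjoint]
  rw [defectSpace_eq hT] at hx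
  refine map_mem_closure T.continuous hx ?_
  rintro _ ⟨y, rfl⟩
  exact ⟨T y, by simp⟩

/-- The operator `-T + z D_{T*} (I - z T*)⁻¹ D_T` on the whole space. For `|z| < 1` and a
contraction `T`, the operator `I - z T*` is invertible. -/
def charOp (T : H →L[ℂ] H) (z : ℂ) : H →L[ℂ] H :=
  -T + z • (defectOp (adjoint T) * Ring.inverse (1 - z • adjoint T) * defectOp T)

theorem charOp_mem_defectSpace {T : H →L[ℂ] H} (hT : ‖T‖ ≤ 1) (z : ℂ) (x : defectSpace T) :
    charOp T z x ∈ defectSpace (adjoint T) := by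
  refine add_mem (neg_mem (map_mem_defectSpace hT x.2)) (Submodule.smul_mem _ _ ?_)
  exact Submodule.le_topologicalClosure _ ⟨_, rfl⟩

/-- The Sz.-Nagy--Foias characteristic function of a contraction `T`: the restriction of
`-T + z D_{T*} (I - z T*)⁻¹ D_T` to the defect subspace of `T`, as an operator from the defect
subspace of `T` to the defect subspace of `T*`. -/
def charFunction (T : H →L[ℂ] H) (hT : ‖T‖ ≤ 1) (z : ℂ) :
    defectSpace T →L[ℂ] defectSpace (adjoint T) :=
  ((charOp T z).comp (defectSpace T).subtypeL).codRestrict (defectSpace (adjoint T))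
    (charOp_mem_defectSpace hT z)

end Operators

/-- Two operators on Hilbert spaces are unitarily equivalent. -/
def UnitarilyEquivalent {H K : Type*}
    [NormedAddCommGroup H] [InnerProductSpace ℂ H]
    [NormedAddCommGroup K] [InnerProductSpace ℂ K]
    (T : H →L[ℂ] H) (S : K →L[ℂ] K) : Prop :=
  ∃ U : H ≃ₗᵢ[ℂ] K, ∀ h : H, U (T h) = S (U h)

/-- Two operator-valued functions on the open unit disk agree: they coincide up to multiplication
from both sides by constant unitary operators. -/
def Agree {M₁ N₁ M₂ N₂ : Type*}
    [NormedAddCommGroup M₁] [InnerProductSpace ℂ M₁]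
    [NormedAddCommGroup N₁] [InnerProductSpace ℂ N₁]
    [NormedAddCommGroup M₂] [InnerProductSpace ℂ M₂]
    [NormedAddCommGroup N₂] [InnerProductSpace ℂ N₂]
    (Θ₁ : ℂ → M₁ →L[ℂ] N₁) (Θ₂ : ℂ → M₂ →L[ℂ] N₂) : Prop :=
  ∃ (V : N₁ ≃ₗᵢ[ℂ] N₂) (W : M₂ ≃ₗᵢ[ℂ] M₁),
    ∀ z : ℂ, ‖z‖ < 1 → ∀ x : M₂, V (Θ₁ z (W x)) = Θ₂ z x

/-- The Borel sigma-algebra of the unit circle. -/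
instance instMeasurableSpaceCircle : MeasurableSpace Circle := borel Circle

instance instBorelSpaceCircle : BorelSpace Circle := ⟨rfl⟩

section Measures

variable (μ : Measure Circle)

/-- The Carathéodory function of `μ`: `F(z) = ∫ (ζ + z) / (ζ - z) dμ(ζ)`. -/
def caratheodoryFunction (z : ℂ) : ℂ :=
  ∫ ζ : Circle, ((ζ : ℂ) + z) / ((ζ : ℂ) - z) ∂μ

/-- The Schur function of `μ`: `f(z) = (1 / z) (F(z) - 1) / (F(z) + 1)`, where `F` is the
Carathéodory function. At `z = 0`, where `(F - 1) / (F + 1)` vanishes if `μ` is a probability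
measure, the value is the one that removes the singularity. -/
def schurFunction (z : ℂ) : ℂ :=
  if z = 0 then
    deriv (fun w : ℂ => (caratheodoryFunction μ w - 1) / (caratheodoryFunction μ w + 1)) 0
  else
    1 / z * ((caratheodoryFunction μ z - 1) / (caratheodoryFunction μ z + 1))

theorem memLp_mulZeta (h : Lp ℂ 2 μ) : MemLp (fun ζ : Circle => (ζ : ℂ) * h ζ) 2 μ := by
  refine (Lp.memLp h).of_le ?_ (Filter.Eventually.of_forall fun ζ => by
    rw [norm_mul, Circle.norm_coe, one_mul])
  exact (Continuous.aestronglyMeasurable (by fun_prop)).mul (Lp.aestronglyMeasurable h)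

/-- Multiplication by the independent variable, `h(ζ) ↦ ζ h(ζ)`, as an isometry of `L²(μ)`. -/
def mulZeta : Lp ℂ 2 μ →ₗᵢ[ℂ] Lp ℂ 2 μ where
  toFun h := (memLp_mulZeta μ h).toLp _
  map_add' f g := by
    rw [← MemLp.toLp_add, MemLp.toLp_eq_toLp_iff]
    filter_upwards [Lp.coeFn_add f g] with ζ h
    rw [Pi.add_apply] at h ⊢
    rw [h, mul_add]
  map_smul' c f := by
    rw [RingHom.id_apply, ← MemLp.toLp_const_smul, MemLp.toLp_eq_toLp_iff]
    filter_upwards [Lp.coeFn_smul c f] with ζ h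
    rw [Pi.smul_apply] at h ⊢
    rw [h, smul_eq_mul, smul_eq_mul, mul_left_comm]
  norm_map' f := by
    change ‖(memLp_mulZeta μ f).toLp _‖ = ‖f‖
    rw [Lp.norm_toLp, Lp.norm_def]
    congr 1
    exact eLpNorm_congr_norm_ae (Filter.Eventually.of_forall fun ζ => by rw [norm_mul, Circle.norm_coe, one_mul])

/-- The subspace of constant functions in `L²(μ)`. -/
def constants [IsFiniteMeasure μ] : Submodule ℂ (Lp ℂ 2 μ) :=
  (Lp.constL 2 μ ℂ : ℂ →L[ℂ] Lp ℂ 2 μ).range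

/-- The model space `L²(μ) ⊖ ℂ`: the orthogonal complement of the constant functions. -/
def modelSpace [IsFiniteMeasure μ] : Submodule ℂ (Lp ℂ 2 μ) :=
  (constants μ)ᗮ

instance instCompleteSpaceModelSpace [IsFiniteMeasure μ] : CompleteSpace (modelSpace μ) :=
  inferInstanceAs (CompleteSpace (constants μ)ᗮ)

/-- The compression `h ↦ P(ζ h)` of multiplication by `ζ` to `L²(μ) ⊖ ℂ`, where `P` is the
orthogonal projection of `L²(μ)` onto `L²(μ) ⊖ ℂ`. -/
def compression [IsFiniteMeasure μ] : modelSpace μ →L[ℂ] modelSpace μ :=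
  (modelSpace μ).orthogonalProjectionOnto.comp
    ((mulZeta μ).toContinuousLinearMap.comp (modelSpace μ).subtypeL)

end Measures

end RankOneDefect

end

/-! Rank one defects mean `D_T = d⟨e,·⟩e` and `D_{T*} = d⟨e',·⟩e'` with the same `d`, and `T e = α
e'`. This makes the block operator `(c, x) ↦ (-α̅ c + d⟨e, x⟩, d c e' + T x)` on `ℂ ⊕ H` a unitary
`U` whose compression to `H` is `T` (`colligation`). The measure `μ` is the spectral measure of `U`
at `v = (1, 0)`.

The spectral isometry from `L²(μ)` sends `1` to `v` and multiplication by `ζ` to `U`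
(`exists_spectral_isometry`). It is onto: the complement of its range reduces `U` and lies in `H`,
so `T` is unitary there, and complete nonunitarity makes it zero
(`eq_bot_of_isCompletelyNonunitary`). Constants then correspond to `ℂ` and `L²(μ) ⊖ ℂ` to `H`, which
is the first statement.

For the second, `F(z) = 2⟨v, y⟩ - 1` with `y = (1 - zU*)⁻¹v`. Solving for `y` by blocks gives `⟨v,
y⟩ = 1/(1 - zφ(z))`, where `Θ_T(z) e = φ(z) e'` (`resolvent_fst_mul`, `charOp_apply`). Hence `(F -
1)/(F + 1) = zφ`, so `f = φ`. -/

noncomputable section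

open scoped InnerProductSpace ComplexConjugate ComplexOrder

namespace RankOneDefect

/-! ### Spectral measure of a unitary operator at a vector -/

section SpectralMeasure

variable {K : Type*} [NormedAddCommGroup K] [InnerProductSpace ℂ K] [CompleteSpace K]

/-- The inclusion of real into complex continuous functions. -/
def ofRealMap {X : Type*} [TopologicalSpace X] (f : C(X, ℝ)) : C(X, ℂ) where
  toFun x := (f x : ℂ)

/-- A representation of `C(X)` has a scalar spectral measure at every vector. -/
theorem exists_scalar_spectral_measure {X : Type*} [TopologicalSpace X] [T2Space X]
    [CompactSpace X] [MeasurableSpace X] [BorelSpace X]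
    (Φ : C(X, ℂ) →⋆ₐ[ℂ] (K →L[ℂ] K)) (v : K) :
    ∃ μ : Measure X, μ.Regular ∧ IsFiniteMeasure μ ∧
      ∀ g : C(X, ℂ), ∫ x, ‖g x‖ ^ 2 ∂μ = ‖Φ g v‖ ^ 2 := by
  have hsq : ∀ g : C(X, ℂ), (⟪v, Φ (star g * g) v⟫_ℂ).re = ‖Φ g v‖ ^ 2 := by
    intro g
    have h : ⟪v, Φ (star g * g) v⟫_ℂ = ⟪Φ g v, Φ g v⟫_ℂ := by
      rw [map_mul, map_star, _root_.mul_apply_eq_comp, ContinuousLinearMap.star_eq_adjoint,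
        ContinuousLinearMap.adjoint_inner_right]
    rw [h, inner_self_eq_norm_sq_to_K]
    norm_cast
  let L : CompactlySupportedContinuousMap X ℝ →ₗ[ℝ] ℝ :=
    { toFun f := (⟪v, Φ (ofRealMap f.toContinuousMap) v⟫_ℂ).re
      map_add' f g := by
        have h : ofRealMap (f + g).toContinuousMap
            = ofRealMap f.toContinuousMap + ofRealMap g.toContinuousMap := by
          ext x; simp [ofRealMap]
        rw [h, map_add, _root_.add_apply, inner_add_right, Complex.add_re]
      map_smul' c f := by
        have h : ofRealMap (c • f).toContinuousMap = (c : ℂ) • ofRealMap f.toContinuousMap := by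
          ext x; simp [ofRealMap]
        rw [h, map_smul, _root_.smul_apply, inner_smul_right]
        simp }
  have hL : ∀ f, 0 ≤ f → 0 ≤ L f := by
    intro f hf
    -- Positivity comes from `f = star √f * √f`, which turns the functional into `‖Φ(√f) v‖²`.
    have h : ofRealMap f.toContinuousMap
        = star (ofRealMap ⟨fun x => Real.sqrt (f x), by fun_prop⟩)
          * ofRealMap ⟨fun x => Real.sqrt (f x), by fun_prop⟩ := by
      ext x
      have hx : 0 ≤ f x := hf x
      simp [ofRealMap, ← Complex.ofReal_mul, Real.mul_self_sqrt hx]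
    change 0 ≤ (⟪v, Φ (ofRealMap f.toContinuousMap) v⟫_ℂ).re
    rw [h, hsq]
    positivity
  let Λ := PositiveLinearMap.mk₀ L hL
  refine ⟨RealRMK.rieszMeasure Λ, inferInstance, inferInstance, fun g => ?_⟩
  let f : CompactlySupportedContinuousMap X ℝ :=
    ⟨⟨fun x => ‖g x‖ ^ 2, by fun_prop⟩, HasCompactSupport.of_compactSpace _⟩
  have hf : ofRealMap f.toContinuousMap = star g * g := by
    ext x
    simp [ofRealMap, f, Complex.conj_mul']
  rw [← hsq, ← hf]
  exact RealRMK.integral_rieszMeasure Λ f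

/-- The inclusion of the circle into the complex plane, as a continuous function. -/
def circleCoe : C(Circle, ℂ) where
  toFun ζ := ζ

/-- The continuous functional calculus of a unitary operator, on the whole circle. -/
theorem exists_circle_calculus {U : K →L[ℂ] K} (hU : U ∈ unitary (K →L[ℂ] K)) :
    ∃ Φ : C(Circle, ℂ) →⋆ₐ[ℂ] (K →L[ℂ] K), Φ circleCoe = U := by
  have hn : IsStarNormal U := ⟨by
    rw [commute_iff_eq, Unitary.star_mul_self_of_mem hU, Unitary.mul_star_self_of_mem hU]⟩
  -- The spectrum lies in the circle; restricting functions along `j` puts the calculus, and later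
  -- the measure, on the whole circle.
  let j : C(spectrum ℂ U, Circle) :=
    ⟨fun z => ⟨z, by
      simpa [Submonoid.unitSphere] using spectrum.norm_eq_one_of_unitary hU z.2⟩, by fun_prop⟩
  refine ⟨(cfcHom hn).comp (ContinuousMap.compStarAlgHom' ℂ ℂ j), ?_⟩
  have h : ContinuousMap.compStarAlgHom' ℂ ℂ j circleCoe
      = (ContinuousMap.id ℂ).restrict (spectrum ℂ U) := by
    ext z; rfl
  rw [StarAlgHom.comp_apply, h]
  exact cfcHom_id hn

theorem norm_toLp_sq (μ : Measure Circle) [IsFiniteMeasure μ] (g : C(Circle, ℂ)) :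
    ‖ContinuousMap.toLp (E := ℂ) 2 μ ℂ g‖ ^ 2 = ∫ x, ‖g x‖ ^ 2 ∂μ := by
  have h := L2.inner_def (𝕜 := ℂ) (ContinuousMap.toLp (E := ℂ) 2 μ ℂ g)
    (ContinuousMap.toLp (E := ℂ) 2 μ ℂ g)
  have h2 : ∫ x, ⟪ContinuousMap.toLp (E := ℂ) 2 μ ℂ g x, ContinuousMap.toLp (E := ℂ) 2 μ ℂ g x⟫_ℂ ∂μ
      = ((∫ x, ‖g x‖ ^ 2 ∂μ : ℝ) : ℂ) := by
    rw [← integral_complex_ofReal]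
    refine integral_congr_ae ?_
    filter_upwards [ContinuousMap.coeFn_toLp (p := 2) (𝕜 := ℂ) μ g] with x hx
    rw [hx, inner_self_eq_norm_sq_to_K]
    norm_cast
  rw [h2, inner_self_eq_norm_sq_to_K] at h
  exact Complex.ofReal_injective ((Complex.ofReal_pow _ _).trans h)

theorem mulZeta_toLp (μ : Measure Circle) [IsFiniteMeasure μ] (g : C(Circle, ℂ)) :
    mulZeta μ (ContinuousMap.toLp 2 μ ℂ g) = ContinuousMap.toLp 2 μ ℂ (circleCoe * g) := by
  apply Lp.ext
  filter_upwards [ContinuousMap.coeFn_toLp (p := 2) (𝕜 := ℂ) μ g,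
    ContinuousMap.coeFn_toLp (p := 2) (𝕜 := ℂ) μ (circleCoe * g),
    (memLp_mulZeta μ (ContinuousMap.toLp 2 μ ℂ g)).coeFn_toLp] with x h1 h2 h3
  refine h3.trans ?_
  rw [h1, h2]
  rfl

theorem constL_one_eq_toLp (μ : Measure Circle) [IsFiniteMeasure μ] :
    Lp.constL 2 μ ℂ (1 : ℂ) = ContinuousMap.toLp 2 μ ℂ (1 : C(Circle, ℂ)) := by
  apply Lp.ext
  filter_upwards [ContinuousMap.coeFn_toLp (p := 2) (𝕜 := ℂ) μ (1 : C(Circle, ℂ)),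
    Lp.coeFn_const (μ := μ) (p := 2) (1 : ℂ)] with x h1 h2
  rw [h1]
  exact h2

/-- The spectral theorem for the cyclic subspace of a unitary operator generated by a unit
vector. -/
theorem exists_spectral_isometry {U : K →L[ℂ] K} (hU : U ∈ unitary (K →L[ℂ] K)) {v : K}
    (hv : ‖v‖ = 1) :
    ∃ (μ : Measure Circle) (_ : IsProbabilityMeasure μ) (W : Lp ℂ 2 μ →ₗᵢ[ℂ] K),
      W (Lp.constL 2 μ ℂ 1) = v ∧ ∀ h, W (mulZeta μ h) = U (W h) := by
  obtain ⟨Φ, hΦ⟩ := exists_circle_calculus hU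
  obtain ⟨μ, hr, hfin, hμ⟩ := exists_scalar_spectral_measure Φ v
  have hprob : IsProbabilityMeasure μ := by
    have h := hμ 1
    simp only [ContinuousMap.one_apply, norm_one, one_pow, map_one,
      _root_.one_apply_eq_self, hv, integral_const, smul_eq_mul, mul_one] at h
    exact isProbabilityMeasure_iff_real.2 h
  let φ : C(Circle, ℂ) →ₗ[ℂ] K :=
    { toFun g := Φ g v
      map_add' f g := by rw [map_add, _root_.add_apply]
      map_smul' c f := by rw [map_smul, _root_.smul_apply, RingHom.id_apply] }
  let e : C(Circle, ℂ) →ₗ[ℂ] Lp ℂ 2 μ := (ContinuousMap.toLp 2 μ ℂ).toLinearMap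
  have hdense : DenseRange e := ContinuousMap.toLp_denseRange ℂ μ ℂ (by norm_num)
  -- By the choice of `μ`, the map `g ↦ Φ g v` is isometric for the `L²(μ)` norm, so it extends from
  -- the dense image of `C(Circle)`.
  have hnorm : ∀ g, ‖φ g‖ = ‖e g‖ := fun g => by
    have h : ‖φ g‖ ^ 2 = ‖e g‖ ^ 2 := ((norm_toLp_sq μ g).trans (hμ g)).symm
    exact (sq_eq_sq₀ (norm_nonneg _) (norm_nonneg _)).1 h
  have hext : ∀ g, φ.extendOfNorm e (e g) = φ g := fun g =>
    LinearMap.extendOfNorm_eq hdense ⟨1, fun g => by rw [one_mul, hnorm]⟩ g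
  let W : Lp ℂ 2 μ →ₗᵢ[ℂ] K :=
    { toLinearMap := (φ.extendOfNorm e).toLinearMap
      norm_map' := fun h => by
        change ‖φ.extendOfNorm e h‖ = ‖h‖
        refine hdense.induction_on (p := fun h => ‖φ.extendOfNorm e h‖ = ‖h‖) h
          (isClosed_eq (by fun_prop) (by fun_prop)) fun g => ?_
        rw [hext, hnorm] }
  have hW : ∀ g, W (ContinuousMap.toLp 2 μ ℂ g) = Φ g v := hext
  refine ⟨μ, hprob, W, ?_, fun h => ?_⟩
  · rw [constL_one_eq_toLp, hW, map_one, _root_.one_apply_eq_self]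
  · refine hdense.induction_on (p := fun h => W (mulZeta μ h) = U (W h)) h
      (isClosed_eq (W.continuous.comp (mulZeta μ).continuous) (U.continuous.comp W.continuous))
      fun g => ?_
    change W (mulZeta μ (ContinuousMap.toLp 2 μ ℂ g)) = U (W (ContinuousMap.toLp 2 μ ℂ g))
    rw [mulZeta_toLp, hW, hW, map_mul, hΦ, _root_.mul_apply_eq_comp]

end SpectralMeasure

/-! ### Carathéodory function and resolvent -/

theorem circle_sub_ne_zero {z : ℂ} (hz : ‖z‖ < 1) (ζ : Circle) : (ζ : ℂ) - z ≠ 0 := by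
  intro h
  rw [sub_eq_zero] at h
  rw [← h, Circle.norm_coe] at hz
  exact lt_irrefl _ hz

/-- The Carathéodory function of the spectral measure, through the resolvent. -/
theorem exists_resolvent_vector {K : Type*} [NormedAddCommGroup K] [InnerProductSpace ℂ K]
    {μ : Measure Circle} [IsProbabilityMeasure μ] {U : K →L[ℂ] K}
    {v : K} {W : Lp ℂ 2 μ →ₗᵢ[ℂ] K} (hW : W (Lp.constL 2 μ ℂ 1) = v)
    (hWU : ∀ h, W (mulZeta μ h) = U (W h)) {z : ℂ} (hz : ‖z‖ < 1) :
    ∃ y : K, U y - z • y = U v ∧ caratheodoryFunction μ z = 2 * ⟪v, y⟫_ℂ - 1 := by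
  -- The symbol of `U(U - z)⁻¹`, chosen because `(ζ + z)/(ζ - z) = 2ζ/(ζ - z) - 1`.
  let g : C(Circle, ℂ) :=
    ⟨fun ζ => ζ / (ζ - z), by
      exact Continuous.div (by fun_prop) (by fun_prop) (circle_sub_ne_zero hz)⟩
  refine ⟨W (ContinuousMap.toLp 2 μ ℂ g), ?_, ?_⟩
  · rw [← hW, ← hWU, ← hWU, ← map_smul, ← map_sub, constL_one_eq_toLp, mulZeta_toLp,
      mulZeta_toLp, ← map_smul, ← map_sub]
    congr 2
    ext ζ
    have h := circle_sub_ne_zero hz ζ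
    simp only [g, circleCoe, ContinuousMap.sub_apply, ContinuousMap.mul_apply,
      ContinuousMap.coe_mk, ContinuousMap.smul_apply, smul_eq_mul, ContinuousMap.one_apply]
    change (ζ : ℂ) * (ζ / (ζ - z)) - z * (ζ / (ζ - z)) = ζ * 1
    field_simp
  · have hint : Integrable (fun ζ => g ζ) μ := g.continuous.integrable_of_hasCompactSupport
      (HasCompactSupport.of_compactSpace _)
    have h : ⟪v, W (ContinuousMap.toLp 2 μ ℂ g)⟫_ℂ = ∫ ζ, g ζ ∂μ := by
      rw [← hW, LinearIsometry.inner_map_map, L2.inner_def]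
      refine integral_congr_ae ?_
      filter_upwards [ContinuousMap.coeFn_toLp (p := 2) (𝕜 := ℂ) μ g,
        Lp.coeFn_const (μ := μ) (p := 2) (1 : ℂ)] with ζ h1 h2
      have h2' : (Lp.constL 2 μ ℂ (1 : ℂ)) ζ = 1 := h2
      rw [h1, h2']
      simp
    rw [h, caratheodoryFunction, ← integral_const_mul]
    have h1 : (1 : ℂ) = ∫ _ : Circle, (1 : ℂ) ∂μ := by simp
    conv_rhs => rw [h1]
    rw [← integral_sub (hint.const_mul 2) (integrable_const _)]
    congr 1
    ext ζ
    have h := circle_sub_ne_zero hz ζ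
    simp only [g, ContinuousMap.coe_mk]
    field_simp
    ring

/-! ### Rank one defects and the unitary colligation -/

section Colligation

variable {H : Type*} [NormedAddCommGroup H] [InnerProductSpace ℂ H]

/-- A one-dimensional subspace is isometric to the scalars through any of its unit vectors. -/
theorem exists_equiv_of_span_eq {S : Submodule ℂ H} {e : H} (he : ‖e‖ = 1)
    (hS : Submodule.span ℂ {e} = S) : ∃ E : ℂ ≃ₗᵢ[ℂ] S, ∀ c, (E c : H) = c • e := by
  subst hS
  exact ⟨LinearIsometryEquiv.toSpanUnitSingleton e he, fun c => rfl⟩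

theorem exists_unit_span_eq {S : Submodule ℂ H} (hS : Module.finrank ℂ S = 1) :
    ∃ e : H, ‖e‖ = 1 ∧ Submodule.span ℂ {e} = S := by
  have : Nontrivial S := Module.nontrivial_of_finrank_pos (R := ℂ) (by rw [hS]; norm_num)
  obtain ⟨u, hu⟩ := exists_norm_eq S zero_le_one
  have hu0 : u ≠ 0 := by rintro rfl; simp at hu
  refine ⟨u, hu, ?_⟩
  have h := (finrank_eq_one_iff_of_nonzero u hu0).1 hS
  have h2 := congrArg (Submodule.map S.subtype) h
  rwa [Submodule.map_span, Set.image_singleton, Submodule.map_top, Submodule.range_subtype] at h2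

/-- A positive operator whose range has one-dimensional closure has rank one. -/
theorem exists_rank_one_form [CompleteSpace H] {A : H →L[ℂ] H} (hA : 0 ≤ A)
    (hS : Module.finrank ℂ A.range.topologicalClosure = 1) :
    ∃ (e : H) (d : ℝ), ‖e‖ = 1 ∧ Submodule.span ℂ {e} = A.range.topologicalClosure ∧ 0 ≤ d ∧
      ∀ x, A x = ((d : ℂ) * ⟪e, x⟫_ℂ) • e := by
  obtain ⟨e, he, hspan⟩ := exists_unit_span_eq hS
  have hee : ⟪e, e⟫_ℂ = 1 := by rw [inner_self_eq_norm_sq_to_K, he]; simp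
  have hpos : A.IsPositive := (ContinuousLinearMap.nonneg_iff_isPositive A).1 hA
  have hform : ∀ x, A x = ⟪e, A x⟫_ℂ • e := fun x => by
    have h : A x ∈ Submodule.span ℂ {e} := by
      rw [hspan]; exact Submodule.le_topologicalClosure _ ⟨x, rfl⟩
    obtain ⟨c, hc⟩ := Submodule.mem_span_singleton.1 h
    rw [← hc, inner_smul_right, hee, mul_one]
  obtain ⟨r, hr0, hr⟩ : ∃ r : ℝ, 0 ≤ r ∧ ⟪e, A e⟫_ℂ = r := by
    have hd : 0 ≤ ⟪e, A e⟫_ℂ := hpos.inner_nonneg_right e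
    exact ⟨_, (Complex.le_def.1 hd).1, Complex.eq_re_of_ofReal_le hd⟩
  refine ⟨e, r, he, hspan, hr0, fun x => ?_⟩
  have hsymm : ⟪e, A x⟫_ℂ = ⟪A e, x⟫_ℂ := (hpos.isSymmetric e x).symm
  rw [hform x, hsymm, hform e, inner_smul_left, hr, Complex.conj_ofReal]

variable [CompleteSpace H]

/-- The data of a contraction `T` with rank one defects: unit vectors `e`, `e'` spanning the
defect subspaces of `T` and of its adjoint, the common eigenvalue `d` of the defect
operators, and the scalar `α` with `T e = α e'`. -/
structure DefectData (T : H →L[ℂ] H) (e e' : H) (d : ℝ) (α : ℂ) : Prop where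
  norm_left : ‖e‖ = 1
  norm_right : ‖e'‖ = 1
  map_left : T e = α • e'
  map_right : adjoint T e' = conj α • e
  sq_add_sq : α * conj α + (d : ℂ) * d = 1
  adjoint_map : ∀ x, adjoint T (T x) = x - ((d : ℂ) * d * ⟪e, x⟫_ℂ) • e
  map_adjoint : ∀ x, T (adjoint T x) = x - ((d : ℂ) * d * ⟪e', x⟫_ℂ) • e'

theorem sq_form_of_defectOp {T : H →L[ℂ] H} (hT : ‖T‖ ≤ 1) {e : H} {d : ℝ} (he : ‖e‖ = 1)
    (hD : ∀ x, defectOp T x = ((d : ℂ) * ⟪e, x⟫_ℂ) • e) (x : H) :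
    adjoint T (T x) = x - ((d : ℂ) * d * ⟪e, x⟫_ℂ) • e := by
  have hee : ⟪e, e⟫_ℂ = 1 := by rw [inner_self_eq_norm_sq_to_K, he]; simp
  have h : defectOp T (defectOp T x) = x - adjoint T (T x) :=
    congrArg (fun A : H →L[ℂ] H => A x) (defectOp_mul_self hT)
  rw [hD (defectOp T x), hD x, inner_smul_right, hee, mul_one, ← mul_assoc] at h
  rw [h]
  abel

/-- `T` and `T*` exchange the two defect lines, and adjointness makes their coefficients conjugate.
-/
theorem exists_defectData {T : H →L[ℂ] H} (hT : ‖T‖ ≤ 1)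
    (hdefect : Module.finrank ℂ (defectSpace T) = 1)
    (hdefect_adj : Module.finrank ℂ (defectSpace (adjoint T)) = 1) :
    ∃ (e e' : H) (d : ℝ) (α : ℂ), DefectData T e e' d α ∧
      Submodule.span ℂ {e} = defectSpace T ∧ Submodule.span ℂ {e'} = defectSpace (adjoint T) ∧
      (∀ x, defectOp T x = ((d : ℂ) * ⟪e, x⟫_ℂ) • e) ∧
      ∀ x, defectOp (adjoint T) x = ((d : ℂ) * ⟪e', x⟫_ℂ) • e' := by
  obtain ⟨e, d, he, hspan, hd, hD⟩ := exists_rank_one_form (A := defectOp T)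
    (CFC.sqrt_nonneg (1 - adjoint T * T)) hdefect
  obtain ⟨e', d', he', hspan', hd', hD'⟩ := exists_rank_one_form (A := defectOp (adjoint T))
    (CFC.sqrt_nonneg (1 - adjoint (adjoint T) * adjoint T)) hdefect_adj
  have hT' := norm_adjoint_le_one hT
  have hee : ⟪e, e⟫_ℂ = 1 := by rw [inner_self_eq_norm_sq_to_K, he]; simp
  have hee' : ⟪e', e'⟫_ℂ = 1 := by rw [inner_self_eq_norm_sq_to_K, he']; simp
  have hs : e ∈ defectSpace T :=
    (show Submodule.span ℂ {e} = defectSpace T from hspan) ▸ Submodule.mem_span_singleton_self e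
  have hs' : e' ∈ defectSpace (adjoint T) :=
    (show Submodule.span ℂ {e'} = defectSpace (adjoint T) from hspan') ▸
      Submodule.mem_span_singleton_self e'
  have h1 := map_mem_defectSpace hT hs
  have h2 := map_mem_defectSpace hT' hs'
  rw [adjoint_adjoint] at h2
  rw [← show _ = defectSpace (adjoint T) from hspan'] at h1
  rw [← show _ = defectSpace T from hspan] at h2
  obtain ⟨α, hα⟩ := Submodule.mem_span_singleton.1 h1
  obtain ⟨β, hβ⟩ := Submodule.mem_span_singleton.1 h2
  have hβα : β = conj α := by
    have h : ⟪e, adjoint T e'⟫_ℂ = ⟪T e, e'⟫_ℂ := adjoint_inner_right T e e'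
    rwa [← hα, ← hβ, inner_smul_right, inner_smul_left, hee, hee', mul_one, mul_one] at h
  subst hβα
  have hq := sq_form_of_defectOp hT he hD
  have hq' := sq_form_of_defectOp hT' he' hD'
  rw [adjoint_adjoint] at hq'
  have hsum : α * conj α + (d : ℂ) * d = 1 := by
    have h := congrArg (fun x => ⟪e, x⟫_ℂ) (hq e)
    simp only [← hα, map_smul, ← hβ, inner_sub_right, inner_smul_right, hee] at h
    linear_combination h
  have hsum' : α * conj α + (d' : ℂ) * d' = 1 := by
    have h := congrArg (fun x => ⟪e', x⟫_ℂ) (hq' e')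
    simp only [← hα, map_smul, ← hβ, inner_sub_right, inner_smul_right, hee'] at h
    linear_combination h
  -- Both squares equal `1 - |α|²`, and both numbers are nonnegative.
  have hdd : d' = d := by
    have h : (d : ℂ) * d = d' * d' := by linear_combination hsum - hsum'
    have h' : d * d = d' * d' := by exact_mod_cast h
    exact ((mul_self_inj hd hd').1 h').symm
  subst hdd
  exact ⟨e, e', d', α, ⟨he, he', hα.symm, hβ.symm, hsum, hq, hq'⟩, hspan, hspan', hD, hD'⟩

theorem DefectData.symm {T : H →L[ℂ] H} {e e' : H} {d : ℝ} {α : ℂ} (h : DefectData T e e' d α) :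
    DefectData (adjoint T) e' e d (conj α) where
  norm_left := h.norm_right
  norm_right := h.norm_left
  map_left := h.map_right
  map_right := by rw [adjoint_adjoint, Complex.conj_conj]; exact h.map_left
  sq_add_sq := by rw [Complex.conj_conj, mul_comm (conj α)]; exact h.sq_add_sq
  adjoint_map := by rw [adjoint_adjoint]; exact h.map_adjoint
  map_adjoint := by rw [adjoint_adjoint]; exact h.adjoint_map

/-- The colligation `(c, x) ↦ (-α̅ c + d ⟨e, x⟩, d c e' + T x)` extending `T` to `ℂ ⊕ H`. -/
def colligationMap (T : H →L[ℂ] H) (e e' : H) (d : ℝ) (α : ℂ) :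
    WithLp 2 (ℂ × H) →ₗ[ℂ] WithLp 2 (ℂ × H) where
  toFun p := WithLp.toLp 2 (-conj α * p.fst + d * ⟪e, p.snd⟫_ℂ, ((d : ℂ) * p.fst) • e' + T p.snd)
  map_add' p q := by
    apply WithLp.ofLp_injective
    refine Prod.ext ?_ ?_
    · simp; ring
    · simp [mul_add, add_smul]; abel
  map_smul' c p := by
    apply WithLp.ofLp_injective
    refine Prod.ext ?_ ?_
    · simp; ring
    · simp [smul_smul, mul_left_comm]

/-- The data with `T` and `T*` exchanged give the inverse: the diagonal terms reduce to `|α|² + d² =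
1` and `T*T = 1 - d²⟨e,·⟩e`, and the cross terms cancel by `T*e' = α̅ e`. `DefectData.symm` supplies
the other order. -/
theorem colligationMap_comp {T : H →L[ℂ] H} {e e' : H} {d : ℝ} {α : ℂ}
    (h : DefectData T e e' d α) (p : WithLp 2 (ℂ × H)) :
    colligationMap (adjoint T) e' e d (conj α) (colligationMap T e e' d α p) = p := by
  have hee' : ⟪e', e'⟫_ℂ = 1 := by rw [inner_self_eq_norm_sq_to_K, h.norm_right]; simp
  have hT : ⟪e', T p.snd⟫_ℂ = α * ⟪e, p.snd⟫_ℂ := by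
    rw [← adjoint_inner_left, h.map_right, inner_smul_left, Complex.conj_conj]
  apply WithLp.ofLp_injective
  refine Prod.ext ?_ ?_
  · change -conj (conj α) * (-conj α * p.fst + d * ⟪e, p.snd⟫_ℂ)
      + d * ⟪e', ((d : ℂ) * p.fst) • e' + T p.snd⟫_ℂ = p.fst
    rw [inner_add_right, inner_smul_right, hee', hT, Complex.conj_conj]
    linear_combination p.fst * h.sq_add_sq
  · change ((d : ℂ) * (-conj α * p.fst + d * ⟪e, p.snd⟫_ℂ)) • e
      + adjoint T (((d : ℂ) * p.fst) • e' + T p.snd) = p.snd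
    rw [map_add, map_smul, h.map_right, h.adjoint_map]
    module

theorem colligationMap_inner (T : H →L[ℂ] H) (e e' : H) (d : ℝ) (α : ℂ)
    (p q : WithLp 2 (ℂ × H)) :
    ⟪colligationMap T e e' d α p, q⟫_ℂ
      = ⟪p, colligationMap (adjoint T) e' e d (conj α) q⟫_ℂ := by
  simp only [colligationMap, LinearMap.coe_mk, AddHom.coe_mk, WithLp.prod_inner_apply,
    inner_add_left, inner_add_right, inner_smul_left, inner_smul_right, adjoint_inner_right]
  simp
  ring

/-- The unitary colligation on `ℂ ⊕ H` of a contraction with rank one defects. -/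
def colligation {T : H →L[ℂ] H} {e e' : H} {d : ℝ} {α : ℂ} (h : DefectData T e e' d α) :
    WithLp 2 (ℂ × H) ≃ₗᵢ[ℂ] WithLp 2 (ℂ × H) where
  toLinearEquiv := LinearEquiv.ofLinearMap (colligationMap T e e' d α)
    (colligationMap (adjoint T) e' e d (conj α))
    (LinearMap.ext fun p => by
      have := colligationMap_comp h.symm p
      rwa [adjoint_adjoint, Complex.conj_conj] at this)
    (LinearMap.ext fun p => colligationMap_comp h p)
  norm_map' p := by
    have h1 := colligationMap_inner T e e' d α p (colligationMap T e e' d α p)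
    rw [colligationMap_comp h] at h1
    rw [@norm_eq_sqrt_re_inner ℂ, @norm_eq_sqrt_re_inner ℂ _ _ _ _ p, ← h1]
    rfl

variable {T : H →L[ℂ] H} {e e' : H} {d : ℝ} {α : ℂ}

theorem colligation_apply (h : DefectData T e e' d α) (c : ℂ) (x : H) :
    colligation h (WithLp.toLp 2 (c, x))
      = WithLp.toLp 2 (-conj α * c + d * ⟪e, x⟫_ℂ, ((d : ℂ) * c) • e' + T x) := rfl

theorem colligation_symm_apply (h : DefectData T e e' d α) (c : ℂ) (x : H) :
    (colligation h).symm (WithLp.toLp 2 (c, x))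
      = WithLp.toLp 2 (-α * c + d * ⟪e', x⟫_ℂ, ((d : ℂ) * c) • e + adjoint T x) := by
  have : (colligation h).symm (WithLp.toLp 2 (c, x)) = WithLp.toLp 2
    (-conj (conj α) * c + d * ⟪e', x⟫_ℂ, ((d : ℂ) * c) • e + adjoint T x) := rfl
  rw [this, Complex.conj_conj]

/-! ### Characteristic function and Schur function as scalars -/

theorem isUnit_one_sub_smul_adjoint (hT : ‖T‖ ≤ 1) {z : ℂ} (hz : ‖z‖ < 1) :
    IsUnit (1 - z • adjoint T) := by
  refine isUnit_one_sub_of_norm_lt_one ?_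
  rw [norm_smul]
  exact (mul_le_of_le_one_right (norm_nonneg _) (norm_adjoint_le_one hT)).trans_lt hz

/-- The characteristic function of a contraction with rank one defects, as a scalar function. -/
def charScalar (T : H →L[ℂ] H) (e e' : H) (d : ℝ) (α z : ℂ) : ℂ :=
  -α + z * (d * d * ⟪e', Ring.inverse (1 - z • adjoint T) e⟫_ℂ)

theorem continuousAt_charScalar (hT : ‖T‖ ≤ 1) {z : ℂ} (hz : ‖z‖ < 1) :
    ContinuousAt (charScalar T e e' d α) z := by
  obtain ⟨u, hu⟩ := isUnit_one_sub_smul_adjoint hT hz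
  have h1 : ContinuousAt (fun w : ℂ => Ring.inverse (1 - w • adjoint T)) z := by
    refine ContinuousAt.comp (g := Ring.inverse) ?_ (by fun_prop)
    rw [← hu]
    exact NormedRing.inverse_continuousAt u
  have h2 : ContinuousAt (fun w : ℂ => Ring.inverse (1 - w • adjoint T) e) z :=
    h1.clm_apply continuousAt_const
  unfold charScalar
  fun_prop

theorem charOp_apply (h : DefectData T e e' d α)
    (hD : ∀ x, defectOp T x = ((d : ℂ) * ⟪e, x⟫_ℂ) • e)
    (hD' : ∀ x, defectOp (adjoint T) x = ((d : ℂ) * ⟪e', x⟫_ℂ) • e') (z : ℂ) :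
    charOp T z e = charScalar T e e' d α z • e' := by
  have hee : ⟪e, e⟫_ℂ = 1 := by rw [inner_self_eq_norm_sq_to_K, h.norm_left]; simp
  change -(T e) + z • defectOp (adjoint T) (Ring.inverse (1 - z • adjoint T) (defectOp T e)) = _
  rw [hD, hD', hee, h.map_left, map_smul, inner_smul_right, charScalar]
  module

/-- The resolvent of the colligation expresses the Carathéodory function through the
characteristic function. -/
theorem resolvent_fst_mul (hT : ‖T‖ ≤ 1) (h : DefectData T e e' d α) {z : ℂ} (hz : ‖z‖ < 1)
    {y : WithLp 2 (ℂ × H)}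
    (hy : colligation h y - z • y = colligation h (WithLp.toLp 2 (1, 0))) :
    y.fst * (1 - z * charScalar T e e' d α z) = 1 := by
  -- Applying `U⁻¹` gives `y - zU⁻¹y = v`. The corner of `U⁻¹` on `H` is `T*`, so the second
  -- coordinate is solved by `(1 - zT*)⁻¹`, and substituting it into the first gives `charScalar`.
  have h1 := congrArg (colligation h).symm hy
  rw [map_sub, map_smul, LinearIsometryEquiv.symm_apply_apply,
    LinearIsometryEquiv.symm_apply_apply] at h1
  have h2 : (colligation h).symm y = _ := colligation_symm_apply h y.fst y.snd
  rw [h2] at h1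
  have h3 : y.fst - z * (-α * y.fst + d * ⟪e', y.snd⟫_ℂ) = 1 := congrArg WithLp.fst h1
  have h4 : y.snd - z • (((d : ℂ) * y.fst) • e + adjoint T y.snd) = 0 := congrArg WithLp.snd h1
  have h5 : y.snd = (z * (d * y.fst)) • Ring.inverse (1 - z • adjoint T) e := by
    have h6 : (1 - z • adjoint T) y.snd = (z * (d * y.fst)) • e := by
      change y.snd - z • adjoint T y.snd = _
      rw [sub_eq_iff_eq_add, ← smul_smul, ← smul_add]
      exact sub_eq_zero.1 h4
    have h7 := Ring.inverse_mul_cancel _ (isUnit_one_sub_smul_adjoint hT hz)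
    rw [← map_smul, ← h6]
    exact (congrArg (fun A : H →L[ℂ] H => A y.snd) h7).symm
  rw [h5, inner_smul_right] at h3
  rw [charScalar]
  linear_combination h3

theorem schurFunction_eq {μ : Measure Circle} {φ : ℂ → ℂ} (hφ : ContinuousAt φ 0)
    (hF : ∀ z : ℂ, ‖z‖ < 1 → ∃ l : ℂ, l * (1 - z * φ z) = 1 ∧
      caratheodoryFunction μ z = 2 * l - 1) {z : ℂ} (hz : ‖z‖ < 1) :
    schurFunction μ z = φ z := by
  have hquot : ∀ w : ℂ, ‖w‖ < 1 →
      (caratheodoryFunction μ w - 1) / (caratheodoryFunction μ w + 1) = w * φ w := by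
    intro w hw
    obtain ⟨l, hl, hFl⟩ := hF w hw
    have hl0 : l ≠ 0 := left_ne_zero_of_mul_eq_one hl
    rw [hFl, div_eq_iff (by ring_nf; simpa using hl0)]
    linear_combination 2 * hl
  unfold schurFunction
  split_ifs with h0
  · subst h0
    have hev : (fun w : ℂ => (caratheodoryFunction μ w - 1) / (caratheodoryFunction μ w + 1))
        =ᶠ[nhds 0] fun w => w * φ w := by
      filter_upwards [Metric.ball_mem_nhds (0 : ℂ) one_pos] with w hw
      exact hquot w (by simpa using hw)
    rw [hev.deriv_eq]
    -- The difference quotient of `wφ(w)` at `0` is `φ(w)`, so continuity of `φ` at `0` is enough.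
    refine HasDerivAt.deriv ?_
    rw [hasDerivAt_iff_tendsto_slope]
    refine (hφ.tendsto.mono_left nhdsWithin_le_nhds).congr' ?_
    filter_upwards [self_mem_nhdsWithin] with w hw
    have hw0 : w ≠ 0 := hw
    simp [slope_def_field, hw0]
  · rw [hquot z hz]
    field_simp

end Colligation

/-! ### Cyclicity and the model operator -/

theorem mulZeta_surjective (μ : Measure Circle) : Function.Surjective (mulZeta μ) := by
  intro h
  have hm : MemLp (fun ζ : Circle => conj (ζ : ℂ) * h ζ) 2 μ :=
    (Lp.memLp h).of_le
      ((Continuous.aestronglyMeasurable (by fun_prop)).mul (Lp.aestronglyMeasurable h))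
      (Filter.Eventually.of_forall fun ζ => by
        rw [norm_mul, RCLike.norm_conj, Circle.norm_coe, one_mul])
  refine ⟨hm.toLp _, Lp.ext ?_⟩
  filter_upwards [(memLp_mulZeta μ (hm.toLp _)).coeFn_toLp, hm.coeFn_toLp] with ζ h1 h2
  refine h1.trans ?_
  rw [h2, ← mul_assoc, Complex.mul_conj, Circle.normSq_coe]
  simp

theorem mem_modelSpace_iff {μ : Measure Circle} [IsFiniteMeasure μ] {h : Lp ℂ 2 μ} :
    h ∈ modelSpace μ ↔ ⟪Lp.constL 2 μ ℂ (1 : ℂ), h⟫_ℂ = 0 := by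
  rw [modelSpace, Submodule.mem_orthogonal]
  constructor
  · exact fun hh => hh _ ⟨1, rfl⟩
  · rintro hh _ ⟨c, rfl⟩
    have hc : Lp.constL 2 μ ℂ c = c • Lp.constL 2 μ ℂ (1 : ℂ) := by
      rw [← map_smul, smul_eq_mul, mul_one]
    change ⟪Lp.constL 2 μ ℂ c, h⟫_ℂ = 0
    rw [hc, inner_smul_left, hh, mul_zero]

section Cyclic

variable {H : Type*} [NormedAddCommGroup H] [InnerProductSpace ℂ H]

theorem inner_toLp_one_zero (k : WithLp 2 (ℂ × H)) :
    ⟪(WithLp.toLp 2 (1, 0) : WithLp 2 (ℂ × H)), k⟫_ℂ = k.fst := by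
  rw [WithLp.prod_inner_apply]
  simp

/-- The inclusion of `H` into `ℂ ⊕ H`. -/
def inclSnd : H →ₗᵢ[ℂ] WithLp 2 (ℂ × H) where
  toFun x := WithLp.toLp 2 (0, x)
  map_add' x y := by apply WithLp.ofLp_injective; simp
  map_smul' c x := by apply WithLp.ofLp_injective; simp
  norm_map' x := by
    have h2 : ‖WithLp.toLp 2 ((0 : ℂ), x)‖ ^ 2 = ‖x‖ ^ 2 := by simp
    exact (sq_eq_sq₀ (norm_nonneg _) (norm_nonneg _)).1 h2

theorem inclSnd_snd {k : WithLp 2 (ℂ × H)}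
    (hk : ⟪(WithLp.toLp 2 (1, 0) : WithLp 2 (ℂ × H)), k⟫_ℂ = 0) : inclSnd k.snd = k := by
  rw [inner_toLp_one_zero] at hk
  apply WithLp.ofLp_injective
  exact Prod.ext hk.symm rfl

variable [CompleteSpace H] {T : H →L[ℂ] H} {e e' : H} {d : ℝ} {α : ℂ}

theorem colligation_inclSnd (h : DefectData T e e' d α) (x : H) :
    colligation h (inclSnd x)
      = ((d : ℂ) * ⟪e, x⟫_ℂ) • WithLp.toLp 2 (1, 0) + inclSnd (T x) := by
  refine (colligation_apply h 0 x).trans ?_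
  apply WithLp.ofLp_injective
  refine Prod.ext ?_ ?_ <;> simp [inclSnd]

/-- If `T` is completely nonunitary, then no nonzero vector of `ℂ ⊕ H` is orthogonal to the
subspace generated by `ℂ` under the unitary colligation of `T`. -/
theorem eq_bot_of_isCompletelyNonunitary (hcnu : IsCompletelyNonunitary T)
    (h : DefectData T e e' d α) {N : Submodule ℂ (WithLp 2 (ℂ × H))}
    (hN : IsClosed (N : Set (WithLp 2 (ℂ × H))))
    (hv : ∀ k ∈ N, ⟪(WithLp.toLp 2 (1, 0) : WithLp 2 (ℂ × H)), k⟫_ℂ = 0)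
    (hU : ∀ k ∈ N, colligation h k ∈ N) (hU' : ∀ k ∈ N, (colligation h).symm k ∈ N) :
    N = ⊥ := by
  -- The image under `U` stays in `N`, hence orthogonal to `v`, and its first coordinate is `d⟨e,
  -- x⟩`. So `U` acts on `N` as `T`.
  have hcoll : ∀ x, inclSnd x ∈ N → (d : ℂ) * ⟪e, x⟫_ℂ = 0 ∧
      colligation h (inclSnd x) = inclSnd (T x) := by
    intro x hx
    have h1 := hv _ (hU _ hx)
    rw [colligation_inclSnd, inner_toLp_one_zero] at h1
    have h2 : (d : ℂ) * ⟪e, x⟫_ℂ = 0 := by simpa [inclSnd] using h1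
    exact ⟨h2, by rw [colligation_inclSnd, h2, zero_smul, zero_add]⟩
  have hM : N.comap inclSnd.toLinearMap = ⊥ := by
    have hsurj : ∀ y ∈ N.comap inclSnd.toLinearMap, ∃ x ∈ N.comap inclSnd.toLinearMap,
        T x = y := by
      intro y hy
      have h1 : (colligation h).symm (inclSnd y) ∈ N := hU' _ hy
      have h2 := inclSnd_snd (hv _ h1)
      have h3 : inclSnd ((colligation h).symm (inclSnd y)).snd ∈ N := by rw [h2]; exact h1
      refine ⟨((colligation h).symm (inclSnd y)).snd, h3, ?_⟩
      apply inclSnd.injective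
      rw [← (hcoll _ h3).2, h2, LinearIsometryEquiv.apply_symm_apply]
    refine hcnu _ ?_ ?_ ?_ ?_ hsurj
    · exact hN.preimage inclSnd.continuous
    · intro x hx
      change inclSnd (T x) ∈ N
      rw [← (hcoll x hx).2]
      exact hU _ hx
    · intro x hx
      rw [Submodule.mem_orthogonal] at hx ⊢
      intro y hy
      obtain ⟨w, hw, rfl⟩ := hsurj y hy
      -- The defect term vanishes on `N`, so `⟨Tw, Tx⟩ = ⟨w, x⟩`; as `T` is onto there, the
      -- complement is invariant too.
      have hadj : adjoint T (T w) = w := by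
        rw [h.adjoint_map, mul_assoc, (hcoll w hw).1, mul_zero, zero_smul, sub_zero]
      rw [← adjoint_inner_left, hadj]
      exact hx w hw
    · intro x hx
      rw [← inclSnd.norm_map, ← (hcoll x hx).2, LinearIsometryEquiv.norm_map,
        LinearIsometry.norm_map]
  rw [Submodule.eq_bot_iff] at hM ⊢
  intro k hk
  have h1 := inclSnd_snd (hv k hk)
  have h2 : k.snd = 0 := hM _ (show inclSnd k.snd ∈ N by rw [h1]; exact hk)
  rw [← h1, h2, map_zero]

/-- The spectral isometry of the colligation of a completely nonunitary contraction is onto. -/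
theorem spectral_isometry_surjective (hcnu : IsCompletelyNonunitary T)
    (h : DefectData T e e' d α) {μ : Measure Circle} [IsFiniteMeasure μ]
    {W : Lp ℂ 2 μ →ₗᵢ[ℂ] WithLp 2 (ℂ × H)}
    (hW : W (Lp.constL 2 μ ℂ 1) = WithLp.toLp 2 (1, 0))
    (hWU : ∀ g, W (mulZeta μ g) = colligation h (W g)) : Function.Surjective W := by
  let R : Submodule ℂ (WithLp 2 (ℂ × H)) := LinearMap.range W.toLinearMap
  have hR : IsClosed (R : Set (WithLp 2 (ℂ × H))) :=
    W.isometry.isClosedEmbedding.isClosed_range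
  have : CompleteSpace R := hR.completeSpace_coe
  have hbot : Rᗮ = ⊥ := by
    refine eq_bot_of_isCompletelyNonunitary hcnu h (Submodule.isClosed_orthogonal R) ?_ ?_ ?_
    · exact fun k hk => hk _ ⟨_, hW⟩
    · rintro k hk _ ⟨g, rfl⟩
      -- Invariance of the complement under `U` requires `R ⊆ U R`, that is, surjectivity of
      -- multiplication by `ζ`.
      obtain ⟨g', rfl⟩ := mulZeta_surjective μ g
      change ⟪W (mulZeta μ g'), _⟫_ℂ = 0
      rw [hWU, LinearIsometryEquiv.inner_map_map]
      exact hk _ ⟨g', rfl⟩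
    · rintro k hk _ ⟨g, rfl⟩
      change ⟪W g, _⟫_ℂ = 0
      rw [← (colligation h).inner_map_map, LinearIsometryEquiv.apply_symm_apply, ← hWU]
      exact hk _ ⟨_, rfl⟩
  have htop : R = ⊤ := R.orthogonal_eq_bot_iff.1 hbot
  exact LinearMap.range_eq_top.1 htop

/-- A completely nonunitary contraction with rank one defects is unitarily equivalent to the
compression of multiplication by the independent variable in `L²` of its spectral measure. -/
theorem unitarilyEquivalent_compression (hcnu : IsCompletelyNonunitary T)
    (h : DefectData T e e' d α) {μ : Measure Circle} [IsFiniteMeasure μ]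
    {W : Lp ℂ 2 μ →ₗᵢ[ℂ] WithLp 2 (ℂ × H)}
    (hW : W (Lp.constL 2 μ ℂ 1) = WithLp.toLp 2 (1, 0))
    (hWU : ∀ g, W (mulZeta μ g) = colligation h (W g)) :
    UnitarilyEquivalent T (compression μ) := by
  let E := LinearIsometryEquiv.ofSurjective W (spectral_isometry_surjective hcnu h hW hWU)
  have hEW : ∀ k, W (E.symm k) = k := E.apply_symm_apply
  have hmem : ∀ x, E.symm (inclSnd x) ∈ modelSpace μ := fun x => by
    rw [mem_modelSpace_iff, ← W.inner_map_map, hW, hEW, inner_toLp_one_zero]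
    rfl
  let J : H →ₗᵢ[ℂ] modelSpace μ :=
    { toLinearMap := (E.symm.toLinearEquiv.toLinearMap ∘ₗ inclSnd.toLinearMap).codRestrict
        (modelSpace μ) hmem
      norm_map' := fun x => (E.symm.norm_map _).trans (inclSnd.norm_map x) }
  have hJ : ∀ x, (J x : Lp ℂ 2 μ) = E.symm (inclSnd x) := fun x => rfl
  have hJsurj : Function.Surjective J := by
    intro g
    have hg : inclSnd (W g).snd = W g := inclSnd_snd (by
      rw [← hW, W.inner_map_map]
      exact mem_modelSpace_iff.1 g.2)
    refine ⟨(W g).snd, Subtype.ext ?_⟩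
    rw [hJ, hg]
    exact E.symm_apply_apply _
  refine ⟨LinearIsometryEquiv.ofSurjective J hJsurj, fun x => ?_⟩
  change J (T x) = (modelSpace μ).orthogonalProjectionOnto (mulZeta μ (J x : Lp ℂ 2 μ))
  -- This is `U(0, x) = d⟨e, x⟩ v + (0, T x)` read in `L²(μ)`; the projection kills the constant and
  -- leaves `T x`.
  have hmul : mulZeta μ (J x : Lp ℂ 2 μ)
      = ((d : ℂ) * ⟪e, x⟫_ℂ) • Lp.constL 2 μ ℂ (1 : ℂ) + (J (T x) : Lp ℂ 2 μ) := by
    apply W.injective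
    rw [hWU, hJ, hJ, hEW, map_add, map_smul, hW, hEW, colligation_inclSnd]
  have hconst : (modelSpace μ).orthogonalProjectionOnto (Lp.constL 2 μ ℂ (1 : ℂ)) = 0 := by
    rw [Submodule.orthogonalProjectionOnto_eq_zero_iff]
    exact Submodule.le_orthogonal_orthogonal _ ⟨1, rfl⟩
  rw [hmul, map_add, map_smul, hconst, smul_zero, zero_add,
    Submodule.orthogonalProjectionOnto_mem_subspace_eq_self]

end Cyclic

end RankOneDefect

end

/-! ### The theorem -/

open RankOneDefect

open scoped InnerProductSpace

theorem theorem5p1 {H : Type*} [NormedAddCommGroup H] [InnerProductSpace ℂ H] [CompleteSpace H]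
    (T : H →L[ℂ] H) (hT : ‖T‖ ≤ 1)
    (hcnu : RankOneDefect.IsCompletelyNonunitary T)
    (hdefect : Module.finrank ℂ (RankOneDefect.defectSpace T) = 1)
    (hdefect_adj : Module.finrank ℂ (RankOneDefect.defectSpace (ContinuousLinearMap.adjoint T)) = 1) :
    ∃ (μ : MeasureTheory.Measure Circle) (_ : MeasureTheory.IsProbabilityMeasure μ),
      RankOneDefect.UnitarilyEquivalent T (RankOneDefect.compression μ) ∧
      RankOneDefect.Agree (RankOneDefect.charFunction T hT)
        (fun z => RankOneDefect.schurFunction μ z • ContinuousLinearMap.id ℂ ℂ) := by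
  obtain ⟨e, e', d, α, h, hspan, hspan', hD, hD'⟩ := exists_defectData hT hdefect hdefect_adj
  have hv : ‖(WithLp.toLp 2 (1, 0) : WithLp 2 (ℂ × H))‖ = 1 := by simp
  obtain ⟨μ, hμ, W, hW, hWU⟩ :=
    exists_spectral_isometry (Unitary.linearIsometryEquiv.symm (colligation h)).2 hv
  have hWU' : ∀ g, W (mulZeta μ g) = colligation h (W g) := hWU
  -- The vectors `e` and `e'` that define `U` also identify the defect lines with `ℂ`, so `Θ_T(z)`
  -- becomes exactly `φ(z)`, with no phase to correct.
  obtain ⟨E, hE⟩ := exists_equiv_of_span_eq h.norm_left hspan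
  obtain ⟨E', hE'⟩ := exists_equiv_of_span_eq h.norm_right hspan'
  refine ⟨μ, hμ, unitarilyEquivalent_compression hcnu h hW hWU', E'.symm, E, fun z hz x => ?_⟩
  have hschur : schurFunction μ z = charScalar T e e' d α z := by
    refine schurFunction_eq (continuousAt_charScalar hT (by simp)) (fun w hw => ?_) hz
    obtain ⟨y, hy, hF⟩ := exists_resolvent_vector hW hWU hw
    exact ⟨y.fst, resolvent_fst_mul hT h hw hy, by rw [hF, inner_toLp_one_zero]⟩
  rw [LinearIsometryEquiv.symm_apply_eq]
  apply Subtype.ext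
  change charOp T z (E x : H) = (E' (schurFunction μ z * x) : H)
  rw [hE, hE', map_smul, charOp_apply h hD hD', hschur, smul_smul, mul_comm]
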